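/- For $n\ge 1$ let $\mathcal P_n=\{\vartheta\in\mathbb R^n : \vartheta_k>0 \text{ for all } k,\ \sum_{k=1}^n\vartheta_k=1\}$, an $(n-1)$-dimensional smooth manifold. For $\alpha\in\mathbb R$ let $g_\alpha$ be the Riemannian metric on $\mathcal P_n$ obtained by pulling back the Euclidean metric of $\mathbb R^n$ under the map $\phi_\alpha:\mathcal P_n\to\mathbb R^n$, $$\phi_\alpha(\vartheta)=\begin{cases}\frac{2}{1-\alpha}\bigl(\vartheta_1^{\frac{1-\alpha}2},\dots,\vartheta_n^{\frac{1-\alpha}2}\bigr), & \alpha\neq 1,\\ (\log\vartheta_1,\dots,\log\vartheta_n), & \alpha=1.\end{cases}$$ Then for every $\alpha\in\mathbb R$ and every $\vartheta\in\mathcal P_n$ the scalar curvature of $(\mathcal P_n,g_\alpha)$ at $\vartheta$ is $$\mathrm{Scal}(\vartheta)=\frac{(1+\alpha)^2}{4c(\vartheta)^2}\sum_{\substack{t,s=1\\ t\ne s}}^n\vartheta_t^{\alpha}\vartheta_s^{\alpha}\left(1-\frac{\vartheta_t^{\alpha+1}+\vartheta_s^{\alpha+1}}{c(\vartheta)^2}\right),\qquad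 c(\vartheta)=\sqrt{\sum_{k=1}^n\vartheta_k^{\alpha+1}}.$$ The scalar curvature is normalized as the full trace of the Ricci tensor, so that the round sphere of dimension $d$ and radius $R$ has scalar curvature $d(d-1)/R^2$. -/

import Mathlib

open scoped ContDiff

noncomputable section

namespace AlphaGeometry

/-! ### Scalar curvature of a Riemannian metric in local coordinates -/

/-- The partial derivative `∂ᵢ f` of a real function on coordinate space. -/
def partialDeriv {m : ℕ} (i : Fin m) (f : (Fin m → ℝ) → ℝ) (x : Fin m → ℝ) : ℝ :=
  fderiv ℝ f x (Pi.single i 1)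

/-- The Christoffel symbol of the second kind of the Levi-Civita connection,
`Γᵢⱼᵏ = ½ ∑ₗ gᵏˡ (∂ᵢ gⱼₗ + ∂ⱼ gᵢₗ - ∂ₗ gᵢⱼ)`. -/
def christoffel {m : ℕ} (G : (Fin m → ℝ) → Matrix (Fin m) (Fin m) ℝ)
    (i j k : Fin m) (x : Fin m → ℝ) : ℝ :=
  1 / 2 * ∑ l, (G x)⁻¹ k l *
    (partialDeriv i (fun y => G y j l) x + partialDeriv j (fun y => G y i l) x
      - partialDeriv l (fun y => G y i j) x)

/-- The component along `∂ₗ` of `R(∂ᵢ, ∂ⱼ)∂ₖ = ∇ᵢ∇ⱼ∂ₖ - ∇ⱼ∇ᵢ∂ₖ`. -/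
def riemannTensor {m : ℕ} (G : (Fin m → ℝ) → Matrix (Fin m) (Fin m) ℝ)
    (i j k l : Fin m) (x : Fin m → ℝ) : ℝ :=
  partialDeriv i (christoffel G j k l) x - partialDeriv j (christoffel G i k l) x
    + ∑ p, (christoffel G j k p x * christoffel G i p l x
      - christoffel G i k p x * christoffel G j p l x)

/-- The Ricci tensor: `Ric(∂ⱼ, ∂ₖ)` is the trace of `X ↦ R(X, ∂ⱼ)∂ₖ`. -/
def ricciTensor {m : ℕ} (G : (Fin m → ℝ) → Matrix (Fin m) (Fin m) ℝ)
    (j k : Fin m) (x : Fin m → ℝ) : ℝ :=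
  ∑ i, riemannTensor G i j k i x

/-- The scalar curvature `∑ gʲᵏ Ricⱼₖ` of the metric `∑ gᵢⱼ dxᵢ dxⱼ`. -/
def scalarCurvature {m : ℕ} (G : (Fin m → ℝ) → Matrix (Fin m) (Fin m) ℝ)
    (x : Fin m → ℝ) : ℝ :=
  ∑ j, ∑ k, (G x)⁻¹ j k * ricciTensor G j k x

/-! ### The simplex and its Riemannian metrics -/

/-- The open simplex of strictly positive probability distributions on `n` points. -/
def simplex (n : ℕ) : Set (Fin n → ℝ) :=
  {θ | (∀ k, 0 < θ k) ∧ ∑ k, θ k = 1}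

/-- A smooth local parametrization (inverse of a chart) of the `(n - 1)`-dimensional manifold
`simplex n`, defined on the open set `U` of coordinate space. -/
structure IsLocalParametrization (n : ℕ) (U : Set (Fin (n - 1) → ℝ))
    (ψ : (Fin (n - 1) → ℝ) → (Fin n → ℝ)) : Prop where
  isOpen : IsOpen U
  contDiffOn : ContDiffOn ℝ ∞ ψ U
  injOn : Set.InjOn ψ U
  mapsTo : Set.MapsTo ψ U (simplex n)
  immersion : ∀ x ∈ U, Function.Injective (fderiv ℝ ψ x)

/-- The coordinate matrix `gᵢⱼ(x) = g(∂ᵢψ, ∂ⱼψ)` in the parametrization `ψ` of a metric `g`,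
where `g θ a b` is the inner product of the tangent vectors `a, b` at `θ`. -/
def metricMatrix {m n : ℕ} (g : (Fin n → ℝ) → (Fin n → ℝ) → (Fin n → ℝ) → ℝ)
    (ψ : (Fin m → ℝ) → (Fin n → ℝ)) (x : Fin m → ℝ) : Matrix (Fin m) (Fin m) ℝ :=
  Matrix.of fun i j =>
    g (ψ x) (fderiv ℝ ψ x (Pi.single i 1)) (fderiv ℝ ψ x (Pi.single j 1))

/-- `s` is the scalar curvature at `θ` of the simplex with the Riemannian metric `g`: there are
local coordinates around `θ`, and in all of them the scalar curvature at `θ` is `s`. -/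
def IsScalarCurvatureAt {n : ℕ} (g : (Fin n → ℝ) → (Fin n → ℝ) → (Fin n → ℝ) → ℝ)
    (θ : Fin n → ℝ) (s : ℝ) : Prop :=
  (∃ U ψ, IsLocalParametrization n U ψ ∧ ∃ x ∈ U, ψ x = θ) ∧
  ∀ U ψ, IsLocalParametrization n U ψ → ∀ x ∈ U, ψ x = θ →
    scalarCurvature (metricMatrix g ψ) x = s

/-- The map `φ_α`, on all positive (not necessarily normalized) vectors. -/
def alphaMap {n : ℕ} (α : ℝ) (θ : Fin n → ℝ) : Fin n → ℝ := fun k =>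
  if α = 1 then Real.log (θ k) else 2 / (1 - α) * θ k ^ ((1 - α) / 2)

/-- The metric `g_α`: the pull-back of the Euclidean metric under `φ_α`. -/
def alphaMetric {n : ℕ} (α : ℝ) (θ a b : Fin n → ℝ) : ℝ :=
  ∑ k, fderiv ℝ (alphaMap α) θ a k * fderiv ℝ (alphaMap α) θ b k

/-- The normalization `c(θ)`. -/
def normConst {n : ℕ} (α : ℝ) (θ : Fin n → ℝ) : ℝ :=
  Real.sqrt (∑ k, θ k ^ (α + 1))

end AlphaGeometry

end

noncomputable section

namespace AlphaGeometry

/-! ### Calculus of partial derivatives -/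

section Calculus

variable {m : ℕ} {U : Set (Fin m → ℝ)} {f g : (Fin m → ℝ) → ℝ} {x : Fin m → ℝ}

/-! Through `φ_α` the simplex is an immersed hypersurface of Euclidean space, so its curvature
follows from the Gauss equation once a normal field is known.

The differential of `φ_α` is diagonal with entries `θ_k ^ (-(1+α)/2)`, also when `α = 1`. Tangent
vectors of the simplex have coordinate sum zero, so `N = θ ^ ((1+α)/2)` is normal, with `|N|² = c²`.
It need not be normalized: what matters is that `∂ₖN = D ∂ₖf`, where `f` is the immersion and `D` is
diagonal with entries `d = (1+α)/2 · θ^α` (`partialDeriv_normal`).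

Let `A` be the Jacobian of `f` and `G = AᵀA`. Differentiating `⟨N, ∂ₖf⟩ = 0` shows that the second
fundamental form is `-(B/c²) N` with `B = AᵀDA`. By `gauss_equation` and
`scalarCurvature_of_lowered`, the scalar curvature is `((tr BG⁻¹)² - tr (BG⁻¹)²)/c²`. Cyclicity of
the trace replaces `BG⁻¹` by `DP`, where `P = 1 - NNᵀ/c²` is the tangential projection
(`projection_eq_one_sub`). The difference of traces is then the sum of `d_t d_s` times the principal
2×2 minors of `P` (`trace_formula`). All this is done in an arbitrary parametrization, so
independence of coordinates comes for free. -/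

theorem partialDeriv_mul (i : Fin m) (hf : DifferentiableAt ℝ f x) (hg : DifferentiableAt ℝ g x) :
    partialDeriv i (fun y => f y * g y) x
      = partialDeriv i f x * g x + f x * partialDeriv i g x := by
  simp only [partialDeriv, fderiv_fun_mul hf hg]
  simp
  ring

theorem partialDeriv_sub (i : Fin m) (hf : DifferentiableAt ℝ f x) (hg : DifferentiableAt ℝ g x) :
    partialDeriv i (fun y => f y - g y) x = partialDeriv i f x - partialDeriv i g x := by
  simp only [partialDeriv, fderiv_fun_sub hf hg]
  simp

theorem partialDeriv_sum {ι : Type*} [Fintype ι] (i : Fin m) {F : ι → (Fin m → ℝ) → ℝ}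
    (hF : ∀ a, DifferentiableAt ℝ (F a) x) :
    partialDeriv i (fun y => ∑ a, F a y) x = ∑ a, partialDeriv i (F a) x := by
  simp only [partialDeriv, fderiv_fun_sum (fun a _ => hF a)]
  simp

theorem partialDeriv_congr (hU : IsOpen U) (hx : x ∈ U) (i : Fin m) (h : ∀ y ∈ U, f y = g y) :
    partialDeriv i f x = partialDeriv i g x := by
  have : f =ᶠ[nhds x] g := Filter.eventuallyEq_of_mem (hU.mem_nhds hx) h
  simp only [partialDeriv, this.fderiv_eq]

theorem partialDeriv_const (i : Fin m) (c : ℝ) : partialDeriv i (fun _ => c) x = 0 := by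
  simp [partialDeriv]

theorem contDiffOn_partialDeriv (hU : IsOpen U) (hf : ContDiffOn ℝ ∞ f U) (i : Fin m) :
    ContDiffOn ℝ ∞ (partialDeriv i f) U :=
  (hf.fderiv_of_isOpen hU (by simp)).clm_apply contDiffOn_const

theorem differentiableAt_of_contDiffOn (hU : IsOpen U) (hf : ContDiffOn ℝ ∞ f U) (hx : x ∈ U) :
    DifferentiableAt ℝ f x :=
  (hf.contDiffAt (hU.mem_nhds hx)).differentiableAt (by simp)

theorem partialDeriv_comm (hU : IsOpen U) (hf : ContDiffOn ℝ ∞ f U) (hx : x ∈ U) (i j : Fin m) :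
    partialDeriv i (partialDeriv j f) x = partialDeriv j (partialDeriv i f) x := by
  have hfx := hf.contDiffAt (hU.mem_nhds hx)
  have hs : IsSymmSndFDerivAt ℝ f x := hfx.isSymmSndFDerivAt (by
    rw [minSmoothness_of_isRCLikeNormedField]
    exact WithTop.coe_le_coe.2 (le_top : (2 : ℕ∞) ≤ ⊤))
  have hd : DifferentiableAt ℝ (fderiv ℝ f) x :=
    ((hf.fderiv_of_isOpen hU (m := ∞) (by simp)).contDiffAt (hU.mem_nhds hx)).differentiableAt
      (by simp)
  have key : ∀ v w : Fin m → ℝ,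
      fderiv ℝ (fun y => fderiv ℝ f y v) x w = fderiv ℝ (fderiv ℝ f) x w v := by
    intro v w
    rw [fderiv_clm_apply hd (differentiableAt_const v)]
    simp
  change fderiv ℝ (fun y => fderiv ℝ f y _) x _ = fderiv ℝ (fun y => fderiv ℝ f y _) x _
  rw [key, key, hs.eq]

theorem contDiffOn_det {k : ℕ} {M : (Fin m → ℝ) → Matrix (Fin k) (Fin k) ℝ}
    (hM : ∀ i j, ContDiffOn ℝ ∞ (fun y => M y i j) U) : ContDiffOn ℝ ∞ (fun y => (M y).det) U := by
  simp only [Matrix.det_apply']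
  exact ContDiffOn.sum fun σ _ => contDiffOn_const.mul (contDiffOn_prod fun i _ => hM _ _)

/-- Cramer's rule: the entries of the inverse are minors divided by the nonvanishing determinant. -/
theorem contDiffOn_matrix_inv {k : ℕ} {M : (Fin m → ℝ) → Matrix (Fin k) (Fin k) ℝ}
    (hM : ∀ i j, ContDiffOn ℝ ∞ (fun y => M y i j) U) (hdet : ∀ y ∈ U, (M y).det ≠ 0)
    (i j : Fin k) : ContDiffOn ℝ ∞ (fun y => (M y)⁻¹ i j) U := by
  simp only [Matrix.inv_def, Matrix.smul_apply, smul_eq_mul, Ring.inverse_eq_inv',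
    Matrix.adjugate_apply]
  refine ((contDiffOn_det hM).inv hdet).mul (contDiffOn_det fun a b => ?_)
  by_cases h : a = j
  · subst h
    simp only [Matrix.updateRow_self]
    exact contDiffOn_const
  · simp only [Matrix.updateRow_ne h]
    exact hM a b

end Calculus

/-! ### The Gauss equation of an immersion into Euclidean space -/

section Gauss

variable {m n : ℕ}

/-- The Gram matrix of the partial derivatives of `f`. -/
def gramMatrix (f : Fin n → (Fin m → ℝ) → ℝ) (x : Fin m → ℝ) : Matrix (Fin m) (Fin m) ℝ :=
  Matrix.of fun i j => ∑ a, partialDeriv i (f a) x * partialDeriv j (f a) x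

/-- The component of the second derivative `∂ⱼ∂ₖf` normal to the immersion `f`. -/
def secondFundamentalForm (G : (Fin m → ℝ) → Matrix (Fin m) (Fin m) ℝ)
    (f : Fin n → (Fin m → ℝ) → ℝ) (j k : Fin m) (a : Fin n) (x : Fin m → ℝ) : ℝ :=
  partialDeriv j (partialDeriv k (f a)) x
    - ∑ p, christoffel G j k p x * partialDeriv p (f a) x

variable {U : Set (Fin m → ℝ)} {f : Fin n → (Fin m → ℝ) → ℝ}
  {G : (Fin m → ℝ) → Matrix (Fin m) (Fin m) ℝ} {x : Fin m → ℝ}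

theorem contDiffOn_metric (hU : IsOpen U) (hf : ∀ a, ContDiffOn ℝ ∞ (f a) U)
    (hG : ∀ y ∈ U, G y = gramMatrix f y) (i j : Fin m) :
    ContDiffOn ℝ ∞ (fun y => G y i j) U := by
  have : ContDiffOn ℝ ∞ (fun y => gramMatrix f y i j) U := by
    simp only [gramMatrix, Matrix.of_apply]
    exact ContDiffOn.sum fun a _ =>
      (contDiffOn_partialDeriv hU (hf a) i).mul (contDiffOn_partialDeriv hU (hf a) j)
  exact this.congr fun y hy => by rw [hG y hy]

theorem contDiffOn_christoffel (hU : IsOpen U) (hf : ∀ a, ContDiffOn ℝ ∞ (f a) U)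
    (hG : ∀ y ∈ U, G y = gramMatrix f y) (hdet : ∀ y ∈ U, (G y).det ≠ 0) (i j k : Fin m) :
    ContDiffOn ℝ ∞ (christoffel G i j k) U := by
  have hM := contDiffOn_metric hU hf hG
  have hM' := fun i j k => contDiffOn_partialDeriv hU (hM i j) k
  unfold christoffel
  exact contDiffOn_const.mul (ContDiffOn.sum fun l _ =>
    (contDiffOn_matrix_inv hM hdet k l).mul (((hM' _ _ _).add (hM' _ _ _)).sub (hM' _ _ _)))

theorem partialDeriv_metric (hU : IsOpen U) (hf : ∀ a, ContDiffOn ℝ ∞ (f a) U)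
    (hG : ∀ y ∈ U, G y = gramMatrix f y) (hx : x ∈ U) (i j l : Fin m) :
    partialDeriv i (fun y => G y j l) x
      = ∑ a, (partialDeriv i (partialDeriv j (f a)) x * partialDeriv l (f a) x
        + partialDeriv j (f a) x * partialDeriv i (partialDeriv l (f a)) x) := by
  have hd := fun a k => differentiableAt_of_contDiffOn hU (contDiffOn_partialDeriv hU (hf a) k) hx
  rw [partialDeriv_congr (g := fun y => ∑ a, partialDeriv j (f a) y * partialDeriv l (f a) y)
    hU hx i (fun y hy => by rw [hG y hy]; rfl),
    partialDeriv_sum i (fun a => (hd a j).fun_mul (hd a l))]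
  exact Finset.sum_congr rfl fun a _ => partialDeriv_mul i (hd a j) (hd a l)

/-- Of the six products from differentiating the Gram matrix, symmetry of second derivatives cancels
four and makes the other two equal, absorbing the factor `1/2`. -/
theorem christoffel_eq (hU : IsOpen U) (hf : ∀ a, ContDiffOn ℝ ∞ (f a) U)
    (hG : ∀ y ∈ U, G y = gramMatrix f y) (hx : x ∈ U) (i j k : Fin m) :
    christoffel G i j k x = ∑ l, (G x)⁻¹ k l *
      ∑ a, partialDeriv i (partialDeriv j (f a)) x * partialDeriv l (f a) x := by
  rw [christoffel, Finset.mul_sum]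
  refine Finset.sum_congr rfl fun l _ => ?_
  rw [partialDeriv_metric hU hf hG hx, partialDeriv_metric hU hf hG hx,
    partialDeriv_metric hU hf hG hx, ← Finset.sum_add_distrib, ← Finset.sum_sub_distrib,
    mul_left_comm, Finset.mul_sum]
  congr 1
  refine Finset.sum_congr rfl fun a _ => ?_
  rw [partialDeriv_comm hU (hf a) hx j i, partialDeriv_comm hU (hf a) hx l i,
    partialDeriv_comm hU (hf a) hx l j]
  ring

theorem sum_christoffel_mul_metric (hU : IsOpen U) (hf : ∀ a, ContDiffOn ℝ ∞ (f a) U)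
    (hG : ∀ y ∈ U, G y = gramMatrix f y) (hdet : ∀ y ∈ U, (G y).det ≠ 0) (hx : x ∈ U)
    (i j q : Fin m) :
    ∑ p, christoffel G i j p x * G x p q
      = ∑ a, partialDeriv i (partialDeriv j (f a)) x * partialDeriv q (f a) x := by
  have hsymm : (G x).transpose = G x := by
    rw [hG x hx]; ext a b; simp [gramMatrix, mul_comm]
  have hinv : G x * (G x)⁻¹ = 1 := Matrix.mul_nonsing_inv _ (hdet x hx).isUnit
  set v : Fin m → ℝ := fun l =>
    ∑ a, partialDeriv i (partialDeriv j (f a)) x * partialDeriv l (f a) x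
  have h1 : ∀ p, christoffel G i j p x = ((G x)⁻¹.mulVec v) p := fun p =>
    christoffel_eq hU hf hG hx i j p
  calc ∑ p, christoffel G i j p x * G x p q = ((G x).mulVec ((G x)⁻¹.mulVec v)) q := by
        simp only [h1]
        rw [Matrix.mulVec, dotProduct]
        refine Finset.sum_congr rfl fun p _ => ?_
        rw [mul_comm, ← hsymm, Matrix.transpose_apply, hsymm]
    _ = v q := by rw [Matrix.mulVec_mulVec, hinv, Matrix.one_mulVec]

/-- The Christoffel symbols are the coefficients of the tangential part of `∂ⱼ∂ₖf`, so subtracting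
that part leaves a normal vector. -/
theorem secondFundamentalForm_normal (hU : IsOpen U) (hf : ∀ a, ContDiffOn ℝ ∞ (f a) U)
    (hG : ∀ y ∈ U, G y = gramMatrix f y) (hdet : ∀ y ∈ U, (G y).det ≠ 0) (hx : x ∈ U)
    (j k q : Fin m) :
    ∑ a, secondFundamentalForm G f j k a x * partialDeriv q (f a) x = 0 := by
  have h := sum_christoffel_mul_metric hU hf hG hdet hx j k q
  simp only [secondFundamentalForm, sub_mul, Finset.sum_sub_distrib]
  rw [← h, sub_eq_zero, hG x hx]
  simp only [gramMatrix, Matrix.of_apply, Finset.mul_sum, Finset.sum_mul]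
  rw [Finset.sum_comm]
  simp only [mul_assoc]

theorem contDiffOn_secondFundamentalForm (hU : IsOpen U) (hf : ∀ a, ContDiffOn ℝ ∞ (f a) U)
    (hG : ∀ y ∈ U, G y = gramMatrix f y) (hdet : ∀ y ∈ U, (G y).det ≠ 0)
    (j k : Fin m) (a : Fin n) : ContDiffOn ℝ ∞ (secondFundamentalForm G f j k a) U := by
  unfold secondFundamentalForm
  exact (contDiffOn_partialDeriv hU (contDiffOn_partialDeriv hU (hf a) k) j).sub
    (ContDiffOn.sum fun p _ => (contDiffOn_christoffel hU hf hG hdet j k p).mul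
      (contDiffOn_partialDeriv hU (hf a) p))

theorem partialDeriv_secondFundamentalForm (hU : IsOpen U) (hf : ∀ a, ContDiffOn ℝ ∞ (f a) U)
    (hG : ∀ y ∈ U, G y = gramMatrix f y) (hdet : ∀ y ∈ U, (G y).det ≠ 0) (hx : x ∈ U)
    (i j k : Fin m) (a : Fin n) :
    partialDeriv i (secondFundamentalForm G f j k a) x
      = partialDeriv i (partialDeriv j (partialDeriv k (f a))) x
        - ∑ p, (partialDeriv i (christoffel G j k p) x * partialDeriv p (f a) x
          + christoffel G j k p x * partialDeriv i (partialDeriv p (f a)) x) := by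
  have hd {h : (Fin m → ℝ) → ℝ} (hh : ContDiffOn ℝ ∞ h U) : DifferentiableAt ℝ h x :=
    differentiableAt_of_contDiffOn hU hh hx
  have hΓ := fun p => hd (contDiffOn_christoffel hU hf hG hdet j k p)
  have hp := fun p => hd (contDiffOn_partialDeriv hU (hf a) p)
  have hs : ∀ p, DifferentiableAt ℝ (fun y => christoffel G j k p y * partialDeriv p (f a) y) x :=
    fun p => (hΓ p).mul (hp p)
  change partialDeriv i (fun y => partialDeriv j (partialDeriv k (f a)) y
    - ∑ p, christoffel G j k p y * partialDeriv p (f a) y) x = _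
  rw [partialDeriv_sub i
    (hd (contDiffOn_partialDeriv hU (contDiffOn_partialDeriv hU (hf a) k) j))
    (DifferentiableAt.fun_sum fun p _ => hs p), partialDeriv_sum i hs]
  congr 1
  exact Finset.sum_congr rfl fun p _ => partialDeriv_mul i (hΓ p) (hp p)

/-- Substitute `∂ⱼ∂ₖf = Γⱼₖᵖ ∂ₚf + w` in `∂ᵢ∂ⱼ∂ₖf = ∂ⱼ∂ᵢ∂ₖf`: third derivatives cancel, and the
tangential terms assemble into the curvature. -/
theorem sum_riemannTensor_mul_partialDeriv (hU : IsOpen U) (hf : ∀ a, ContDiffOn ℝ ∞ (f a) U)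
    (hG : ∀ y ∈ U, G y = gramMatrix f y) (hdet : ∀ y ∈ U, (G y).det ≠ 0) (hx : x ∈ U)
    (i j k : Fin m) (a : Fin n) :
    ∑ l, riemannTensor G i j k l x * partialDeriv l (f a) x
      = partialDeriv j (secondFundamentalForm G f i k a) x
        - partialDeriv i (secondFundamentalForm G f j k a) x
        + ∑ p, (christoffel G i k p x * secondFundamentalForm G f j p a x
          - christoffel G j k p x * secondFundamentalForm G f i p a x) := by
  rw [partialDeriv_secondFundamentalForm hU hf hG hdet hx,
    partialDeriv_secondFundamentalForm hU hf hG hdet hx,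
    partialDeriv_comm hU (contDiffOn_partialDeriv hU (hf a) k) hx j i]
  simp only [riemannTensor, secondFundamentalForm, add_mul, sub_mul, mul_sub, Finset.sum_add_distrib,
    Finset.sum_sub_distrib, Finset.sum_mul, Finset.mul_sum]
  rw [Finset.sum_comm (f := fun l p => christoffel G j k p x * christoffel G i p l x *
      partialDeriv l (f a) x),
    Finset.sum_comm (f := fun l p => christoffel G i k p x * christoffel G j p l x *
      partialDeriv l (f a) x)]
  simp only [mul_assoc]
  ring

/-- Differentiating the orthogonality of the second fundamental form to the tangent space. -/
theorem sum_partialDeriv_secondFundamentalForm (hU : IsOpen U)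
    (hf : ∀ a, ContDiffOn ℝ ∞ (f a) U)
    (hG : ∀ y ∈ U, G y = gramMatrix f y) (hdet : ∀ y ∈ U, (G y).det ≠ 0) (hx : x ∈ U)
    (i j k q : Fin m) :
    ∑ a, partialDeriv i (secondFundamentalForm G f j k a) x * partialDeriv q (f a) x
      = -∑ a, secondFundamentalForm G f j k a x * secondFundamentalForm G f i q a x := by
  have hd {h : (Fin m → ℝ) → ℝ} (hh : ContDiffOn ℝ ∞ h U) : DifferentiableAt ℝ h x :=
    differentiableAt_of_contDiffOn hU hh hx
  have hw := fun a => hd (contDiffOn_secondFundamentalForm hU hf hG hdet j k a)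
  have hq := fun a => hd (contDiffOn_partialDeriv hU (hf a) q)
  have h0 : partialDeriv i (fun y => ∑ a, secondFundamentalForm G f j k a y
      * partialDeriv q (f a) y) x = 0 := by
    rw [partialDeriv_congr (g := fun _ => 0) hU hx i fun y hy =>
      secondFundamentalForm_normal hU hf hG hdet hy j k q, partialDeriv_const]
  rw [partialDeriv_sum i fun a => (hw a).fun_mul (hq a)] at h0
  simp only [fun a => partialDeriv_mul i (hw a) (hq a), Finset.sum_add_distrib] at h0
  have h1 : ∑ a, secondFundamentalForm G f j k a x * secondFundamentalForm G f i q a x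
      = ∑ a, secondFundamentalForm G f j k a x * partialDeriv i (partialDeriv q (f a)) x := by
    -- The second fundamental form differs from `∂ᵢ∂_q f` by a tangential vector, which is
    -- orthogonal to the normal first factor.
    conv_lhs => enter [2, a, 2]; rw [secondFundamentalForm]
    simp only [mul_sub, Finset.sum_sub_distrib, Finset.mul_sum]
    rw [sub_eq_self, Finset.sum_comm]
    refine Finset.sum_eq_zero fun p _ => ?_
    simp only [mul_left_comm _ (christoffel G i q p x), ← Finset.mul_sum,
      secondFundamentalForm_normal hU hf hG hdet hx, mul_zero]
  rw [h1]
  linarith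

/-- Pair the previous commutator identity with `∂_q f`: the Christoffel terms multiply normal
vectors and vanish, and the differentiated orthogonality relation turns the rest into products. -/
theorem gauss_equation (hU : IsOpen U) (hf : ∀ a, ContDiffOn ℝ ∞ (f a) U)
    (hG : ∀ y ∈ U, G y = gramMatrix f y) (hdet : ∀ y ∈ U, (G y).det ≠ 0) (hx : x ∈ U)
    (i j k q : Fin m) :
    ∑ l, riemannTensor G i j k l x * G x l q
      = ∑ a, secondFundamentalForm G f j k a x * secondFundamentalForm G f i q a x
        - ∑ a, secondFundamentalForm G f i k a x * secondFundamentalForm G f j q a x := by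
  have hnormal : ∀ i j k : Fin m, ∑ a, (∑ p, christoffel G i k p x *
      secondFundamentalForm G f j p a x) * partialDeriv q (f a) x = 0 := by
    intro i j k
    simp only [Finset.sum_mul]
    rw [Finset.sum_comm]
    refine Finset.sum_eq_zero fun p _ => ?_
    simp only [mul_assoc, ← Finset.mul_sum, secondFundamentalForm_normal hU hf hG hdet hx, mul_zero]
  calc ∑ l, riemannTensor G i j k l x * G x l q
      = ∑ a, (∑ l, riemannTensor G i j k l x * partialDeriv l (f a) x)
          * partialDeriv q (f a) x := by
        rw [hG x hx]
        simp only [gramMatrix, Matrix.of_apply, Finset.mul_sum, Finset.sum_mul]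
        rw [Finset.sum_comm]
        simp only [mul_assoc]
    _ = _ := by
        simp only [sum_riemannTensor_mul_partialDeriv hU hf hG hdet hx, add_mul, sub_mul,
          Finset.sum_add_distrib, Finset.sum_sub_distrib, hnormal,
          sum_partialDeriv_secondFundamentalForm hU hf hG hdet hx]
        ring

end Gauss


/-! ### Scalar curvature of hypersurfaces -/

section Hypersurface

open Matrix

/-- The orthogonal projection onto the column space of `A`, whose orthogonal complement is
spanned by `N`. -/
theorem projection_eq_one_sub {m n : ℕ} (hmn : n = m + 1) (A : Matrix (Fin n) (Fin m) ℝ)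
    (N : Fin n → ℝ) (hdet : (Aᵀ * A).det ≠ 0) (hN : ∀ j, ∑ a, N a * A a j = 0)
    (hN0 : ∑ a, N a ^ 2 ≠ 0) :
    A * (Aᵀ * A)⁻¹ * Aᵀ = 1 - (∑ a, N a ^ 2)⁻¹ • vecMulVec N N := by
  set c := ∑ a, N a ^ 2 with hc
  set G := Aᵀ * A with hG
  have hinv : G⁻¹ * G = 1 := nonsing_inv_mul _ hdet.isUnit
  have hAN : Aᵀ * replicateCol Unit N = 0 := by
    ext j u
    simpa [mul_apply, mul_comm] using hN j
  have hNA : replicateRow Unit N * A = 0 := by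
    ext u j
    simpa [mul_apply] using hN j
  have hNN : replicateRow Unit N * replicateCol Unit N = c • (1 : Matrix Unit Unit ℝ) := by
    ext u v
    simp [mul_apply, hc, pow_two]
  -- The block matrix `[A | N]` is square because `n = m + 1`, so this left inverse is also a right
  -- inverse; the reversed product is the desired decomposition of `1`.
  have hleft : fromRows (G⁻¹ * Aᵀ) (c⁻¹ • replicateRow Unit N) *
      fromCols A (replicateCol Unit N) = 1 := by
    rw [fromRows_mul_fromCols, Matrix.mul_assoc, ← hG, hinv, Matrix.mul_assoc, hAN, smul_mul, hNA,
      smul_mul, hNN, smul_smul, inv_mul_cancel₀ hN0]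
    simp
  have hcard : Fintype.card (Fin m ⊕ Unit) = Fintype.card (Fin n) := by simp [hmn]
  have hright := (mul_eq_one_comm_of_card_eq _ _ _ hcard).1 hleft
  rw [fromCols_mul_fromRows, Matrix.mul_smul, ← Matrix.mul_assoc] at hright
  have hvec : replicateCol Unit N * replicateRow Unit N = vecMulVec N N := by
    ext a b
    simp [mul_apply, vecMulVec_apply]
  rw [← hright, hvec]
  simp

theorem scalarCurvature_of_lowered {m : ℕ} {G : (Fin m → ℝ) → Matrix (Fin m) (Fin m) ℝ}
    {x : Fin m → ℝ} (hdet : (G x).det ≠ 0) (hsymm : (G x)ᵀ = G x) (B : Matrix (Fin m) (Fin m) ℝ)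
    (c : ℝ)
    (h : ∀ i j k q, ∑ l, riemannTensor G i j k l x * G x l q
      = (B j k * B i q - B i k * B j q) / c) :
    scalarCurvature G x = (trace (B * (G x)⁻¹) * trace (B * (G x)⁻¹)
      - trace (B * (G x)⁻¹ * (B * (G x)⁻¹))) / c := by
  have hinv : G x * (G x)⁻¹ = 1 := mul_nonsing_inv _ hdet.isUnit
  have hisymm : ∀ a b, (G x)⁻¹ a b = (G x)⁻¹ b a := fun a b => by
    conv_lhs => rw [← hsymm, ← transpose_nonsing_inv, transpose_apply]
  set H := (G x)⁻¹ with hH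
  have hR : ∀ i j k l, riemannTensor G i j k l x
      = ∑ q, (B j k * B i q - B i k * B j q) / c * H q l := by
    intro i j k l
    have : (fun l => riemannTensor G i j k l x) =
        (fun q => (B j k * B i q - B i k * B j q) / c) ᵥ* H := by
      have h1 : (fun l => riemannTensor G i j k l x) ᵥ* G x =
          fun q => (B j k * B i q - B i k * B j q) / c := funext fun q => h i j k q
      rw [← h1, vecMul_vecMul, hinv, vecMul_one]
    exact congrFun this l
  simp only [scalarCurvature, ricciTensor, hR]
  have hsum : ∑ i, ∑ q, B i q * H q i = trace (B * H) := by
    simp only [trace, diag, mul_apply]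
  have hsum' : ∑ j, ∑ k, H j k * B j k = trace (B * H) := by
    rw [← hsum]
    exact Finset.sum_congr rfl fun j _ => Finset.sum_congr rfl fun k _ => by
      rw [hisymm j k, mul_comm]
  have h1 : trace (B * H) * trace (B * H) = ∑ j, ∑ k, ∑ i, ∑ q, H j k * (B j k * B i q * H q i) := by
    rw [← hsum']
    nth_rewrite 2 [hsum']
    rw [← hsum]
    simp only [Finset.sum_mul, Finset.mul_sum]
    exact Finset.sum_congr rfl fun j _ => Finset.sum_congr rfl fun k _ =>
      Finset.sum_congr rfl fun i _ => Finset.sum_congr rfl fun q _ => by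
        rw [hisymm j k, hisymm q i]; ring
  have h2 : trace (B * H * (B * H)) = ∑ j, ∑ k, ∑ i, ∑ q, H j k * (B i k * B j q * H q i) := by
    calc trace (B * H * (B * H)) = ∑ i, ∑ j, ∑ k, ∑ q, B i k * H k j * (B j q * H q i) := by
          simp only [trace, diag, mul_apply (M := B * H), mul_apply (M := B), Finset.sum_mul_sum]
      _ = ∑ j, ∑ k, ∑ i, ∑ q, B i k * H k j * (B j q * H q i) := by
          rw [Finset.sum_comm]
          exact Finset.sum_congr rfl fun j _ => Finset.sum_comm
      _ = _ := Finset.sum_congr rfl fun j _ => Finset.sum_congr rfl fun k _ =>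
          Finset.sum_congr rfl fun i _ => Finset.sum_congr rfl fun q _ => by
            rw [hisymm k j]; ring
  rw [h1, h2]
  simp only [← Finset.sum_sub_distrib, Finset.sum_div, Finset.mul_sum]
  exact Finset.sum_congr rfl fun j _ => Finset.sum_congr rfl fun k _ =>
    Finset.sum_congr rfl fun i _ => Finset.sum_congr rfl fun q _ => by ring

/-- With `P` the projection, the `(t, s)` term is `d t * d s` times `P t t * P s s - P t s * P s t`.
It vanishes for `t = s`; otherwise the products of four `N` factors cancel. -/
theorem trace_formula {m n : ℕ} (hmn : n = m + 1) (A : Matrix (Fin n) (Fin m) ℝ)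
    (N d : Fin n → ℝ) (hdet : (Aᵀ * A).det ≠ 0) (hN : ∀ j, ∑ a, N a * A a j = 0)
    (hN0 : ∑ a, N a ^ 2 ≠ 0) :
    trace (Aᵀ * diagonal d * A * (Aᵀ * A)⁻¹) * trace (Aᵀ * diagonal d * A * (Aᵀ * A)⁻¹)
      - trace (Aᵀ * diagonal d * A * (Aᵀ * A)⁻¹ * (Aᵀ * diagonal d * A * (Aᵀ * A)⁻¹))
    = ∑ t, ∑ s ∈ Finset.univ.filter (fun s => t ≠ s),
        d t * d s * (1 - (N t ^ 2 + N s ^ 2) / ∑ a, N a ^ 2) := by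
  have hP := projection_eq_one_sub hmn A N hdet hN hN0
  set c := ∑ a, N a ^ 2
  set H := (Aᵀ * A)⁻¹
  set P := A * H * Aᵀ with hPdef
  have h1 : trace (Aᵀ * diagonal d * A * H) = trace (diagonal d * P) := by
    rw [Matrix.mul_assoc, Matrix.mul_assoc, trace_mul_comm, hPdef]
    simp only [Matrix.mul_assoc]
  have h2 : trace (Aᵀ * diagonal d * A * H * (Aᵀ * diagonal d * A * H))
      = trace (diagonal d * P * (diagonal d * P)) := by
    rw [show Aᵀ * diagonal d * A * H * (Aᵀ * diagonal d * A * H)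
      = Aᵀ * (diagonal d * A * H * (Aᵀ * diagonal d * A * H)) by simp only [Matrix.mul_assoc],
      trace_mul_comm, hPdef]
    simp only [Matrix.mul_assoc]
  have hPab : ∀ a b, P a b = (1 : Matrix (Fin n) (Fin n) ℝ) a b - c⁻¹ * (N a * N b) := by
    intro a b
    rw [hP]
    simp [vecMulVec_apply]
  rw [h1, h2]
  simp only [trace, diag, mul_apply (M := diagonal d * P), diagonal_mul, Finset.sum_mul_sum]
  rw [← Finset.sum_sub_distrib]
  refine Finset.sum_congr rfl fun t _ => ?_
  rw [← Finset.sum_sub_distrib, Finset.sum_filter]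
  refine Finset.sum_congr rfl fun s _ => ?_
  simp only [hPab]
  by_cases hts : t = s
  · subst hts
    simp
  · rw [if_pos hts, one_apply_ne hts, one_apply_ne (Ne.symm hts), one_apply_eq, one_apply_eq]
    ring

/-- Scalar curvature of an immersed hypersurface with normal field `N` of derivative
`∂ₖN = diag(d) ∂ₖf`. -/
theorem scalarCurvature_hypersurface {m n : ℕ} (hmn : n = m + 1) {U : Set (Fin m → ℝ)}
    {f N : Fin n → (Fin m → ℝ) → ℝ} {G : (Fin m → ℝ) → Matrix (Fin m) (Fin m) ℝ}
    {x : Fin m → ℝ} (hU : IsOpen U) (hf : ∀ a, ContDiffOn ℝ ∞ (f a) U)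
    (hG : ∀ y ∈ U, G y = gramMatrix f y) (hdet : ∀ y ∈ U, (G y).det ≠ 0) (hx : x ∈ U)
    (hN : ∀ y ∈ U, ∀ j, ∑ a, N a y * partialDeriv j (f a) y = 0)
    (hNd : ∀ a, DifferentiableAt ℝ (N a) x) (hN0 : ∑ a, N a x ^ 2 ≠ 0) (d : Fin n → ℝ)
    (hd : ∀ a k, partialDeriv k (N a) x = d a * partialDeriv k (f a) x) :
    scalarCurvature G x = (∑ t, ∑ s ∈ Finset.univ.filter (fun s => t ≠ s),
        d t * d s * (1 - (N t x ^ 2 + N s x ^ 2) / ∑ a, N a x ^ 2)) / ∑ a, N a x ^ 2 := by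
  set A : Matrix (Fin n) (Fin m) ℝ := of fun a j => partialDeriv j (f a) x with hA
  have hGA : G x = Aᵀ * A := by
    rw [hG x hx]
    ext i j
    simp [gramMatrix, hA, mul_apply]
  set B := Aᵀ * diagonal d * A with hB
  have hBapply : ∀ j k, B j k = ∑ a, d a * partialDeriv j (f a) x * partialDeriv k (f a) x := by
    intro j k
    rw [hB, mul_apply]
    simp only [mul_diagonal, transpose_apply, hA, of_apply]
    exact Finset.sum_congr rfl fun a _ => by ring
  have hdetx : (Aᵀ * A).det ≠ 0 := hGA ▸ hdet x hx
  have hNx : ∀ j, ∑ a, N a x * A a j = 0 := hN x hx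
  have hP := projection_eq_one_sub hmn A (fun a => N a x) hdetx hNx hN0
  set c := ∑ a, N a x ^ 2 with hc
  -- Differentiate the orthogonality of `N` and `∂ₖf`; the hypothesis on `∂ⱼN` supplies `B`.
  have hNf : ∀ j k, ∑ a, N a x * partialDeriv j (partialDeriv k (f a)) x = -B j k := by
    intro j k
    have hfd := fun a =>
      differentiableAt_of_contDiffOn hU (contDiffOn_partialDeriv hU (hf a) k) hx
    have h0 : partialDeriv j (fun y => ∑ a, N a y * partialDeriv k (f a) y) x = 0 := by
      rw [partialDeriv_congr (g := fun _ => 0) hU hx j fun y hy => hN y hy k, partialDeriv_const]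
    rw [partialDeriv_sum j fun a => (hNd a).fun_mul (hfd a)] at h0
    simp only [fun a => partialDeriv_mul j (hNd a) (hfd a), Finset.sum_add_distrib, hd,
      ← hBapply] at h0
    linarith
  have hw : ∀ j k a, secondFundamentalForm G f j k a x = -(B j k / c * N a x) := by
    intro j k a
    set w : Fin n → ℝ := fun a => secondFundamentalForm G f j k a x with hw
    have hwA : w ᵥ* A = 0 := funext fun q =>
      secondFundamentalForm_normal hU hf hG hdet hx j k q
    have hwN : w ⬝ᵥ (fun a => N a x) = -B j k := by
      rw [← hNf]
      simp only [dotProduct, hw, secondFundamentalForm, sub_mul, Finset.sum_sub_distrib,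
        Finset.sum_mul]
      rw [Finset.sum_comm]
      have : ∀ p, ∑ a, christoffel G j k p x * partialDeriv p (f a) x * N a x = 0 := by
        intro p
        rw [← mul_zero (christoffel G j k p x), ← hN x hx p, Finset.mul_sum]
        exact Finset.sum_congr rfl fun a _ => by ring
      simp only [this, Finset.sum_const_zero, sub_zero, mul_comm (N _ x)]
    -- The projection kills the normal vector `w`, so `w` equals its component along `N`.
    have h1 := congrArg (fun M => (w ᵥ* M) a) hP
    simp only [Matrix.mul_assoc, ← vecMul_vecMul w A, hwA, zero_vecMul, Pi.zero_apply,
      vecMul_sub, vecMul_one, vecMul_smul, vecMul_vecMulVec, Pi.sub_apply, Pi.smul_apply,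
      smul_eq_mul, hwN] at h1
    change w a = _
    rw [div_eq_inv_mul]
    linarith
  have key := scalarCurvature_of_lowered (hdet x hx) (by rw [hGA, transpose_mul, transpose_transpose])
    B c fun i j k q => by
      rw [gauss_equation hU hf hG hdet hx]
      simp only [hw]
      have : ∀ u v : ℝ, ∑ a, -(u / c * N a x) * -(v / c * N a x) = u * v / c := by
        intro u v
        rw [show u * v / c = u / c * (v / c) * c by field_simp, hc, Finset.mul_sum]
        exact Finset.sum_congr rfl fun a _ => by ring
      rw [this, this, sub_div]
  rw [key, hGA, hB, trace_formula hmn A (fun a => N a x) d hdetx hNx hN0]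

end Hypersurface


/-! ### Parametrizations of the simplex -/

theorem exists_isLocalParametrization {n : ℕ} (hn : 1 ≤ n) {θ : Fin n → ℝ} (hθ : θ ∈ simplex n) :
    ∃ U ψ, IsLocalParametrization n U ψ ∧ ∃ x ∈ U, ψ x = θ := by
  obtain ⟨m, rfl⟩ : ∃ m, n = m + 1 := ⟨n - 1, by omega⟩
  change ∃ (U : Set (Fin m → ℝ)) (ψ : (Fin m → ℝ) → (Fin (m + 1) → ℝ)), _
  -- A global chart: forget coordinate `0`, which the other coordinates determine. The forgetful map
  -- `T` is a linear left inverse, giving injectivity of both `ψ` and its derivative.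
  let ψ : (Fin m → ℝ) → (Fin (m + 1) → ℝ) := fun x => Fin.cons (1 - ∑ i, x i) x
  let T : (Fin (m + 1) → ℝ) →L[ℝ] (Fin m → ℝ) :=
    ContinuousLinearMap.pi fun i => ContinuousLinearMap.proj i.succ
  have hT : ∀ x, T (ψ x) = x := fun x => rfl
  have hψ : ContDiff ℝ ∞ ψ := by
    refine contDiff_pi.2 fun k => ?_
    refine Fin.cases ?_ (fun i => ?_) k
    · simp only [ψ, Fin.cons_zero]
      fun_prop
    · simp only [ψ, Fin.cons_succ]
      fun_prop
  refine ⟨{x | (∀ i, 0 < x i) ∧ ∑ i, x i < 1}, ψ, ⟨?_, hψ.contDiffOn, ?_, ?_, ?_⟩,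
    T θ, ⟨fun i => hθ.1 _, ?_⟩, ?_⟩
  · simp only [Set.ofPred_and, Set.ofPred_forall]
    exact (isOpen_iInter_of_finite fun i =>
      isOpen_lt continuous_const (continuous_apply i)).inter
      (isOpen_lt (by fun_prop) continuous_const)
  · exact (Function.LeftInverse.injective hT).injOn
  · rintro x ⟨hx, hsum⟩
    refine ⟨fun k => ?_, ?_⟩
    · refine Fin.cases ?_ (fun i => ?_) k
      · simpa [ψ] using hsum
      · simpa [ψ] using hx i
    · simp [ψ, Fin.sum_univ_succ]
  · intro x _
    have hd : DifferentiableAt ℝ ψ x := hψ.differentiable (by simp) x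
    have hc : HasFDerivAt (T ∘ ψ) (T ∘L fderiv ℝ ψ x) x := T.hasFDerivAt.comp x hd.hasFDerivAt
    have hid : T ∘ ψ = id := funext hT
    rw [hid] at hc
    have := hc.unique (hasFDerivAt_id x)
    exact Function.LeftInverse.injective (g := T) fun v => DFunLike.congr_fun this v
  · have h := hθ.2
    rw [Fin.sum_univ_succ] at h
    have h0 := hθ.1 0
    change ∑ i : Fin m, θ i.succ < 1
    linarith
  · have h := hθ.2
    rw [Fin.sum_univ_succ] at h
    funext k
    refine Fin.cases ?_ (fun i => rfl) k
    change 1 - ∑ i : Fin m, θ i.succ = θ 0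
    linarith

/-! ### The alpha map -/

/-- The factor `2/(1-α)` normalizes the derivative so that one formula covers the logarithmic case
too; everything later avoids splitting on `α = 1`. -/
theorem hasDerivAt_alphaMap_component (α : ℝ) {t : ℝ} (ht : 0 < t) :
    HasDerivAt (fun t : ℝ => if α = 1 then Real.log t else 2 / (1 - α) * t ^ ((1 - α) / 2))
      (t ^ (-((1 + α) / 2))) t := by
  by_cases h : α = 1
  · subst h
    simp only [if_true]
    convert Real.hasDerivAt_log ht.ne' using 1
    norm_num [Real.rpow_neg_one]
  · simp only [h, if_false]
    have h1 : 1 - α ≠ 0 := sub_ne_zero.2 (Ne.symm h)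
    have h2 := (Real.hasDerivAt_rpow_const (p := (1 - α) / 2) (Or.inl ht.ne')).const_mul
      (2 / (1 - α))
    rwa [show (1 - α) / 2 - 1 = -((1 + α) / 2) by ring, ← mul_assoc,
      show 2 / (1 - α) * ((1 - α) / 2) = 1 by field_simp, one_mul] at h2

theorem hasFDerivAt_alphaMap_apply {n : ℕ} (α : ℝ) {θ : Fin n → ℝ} (hθ : ∀ k, 0 < θ k)
    (k : Fin n) :
    HasFDerivAt (fun θ : Fin n → ℝ => alphaMap α θ k)
      (θ k ^ (-((1 + α) / 2)) • ContinuousLinearMap.proj (R := ℝ) k) θ :=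
  HasDerivAt.comp_hasFDerivAt (f := fun θ : Fin n → ℝ => θ k) θ
    (hasDerivAt_alphaMap_component α (hθ k))
    (ContinuousLinearMap.proj (R := ℝ) (φ := fun _ : Fin n => ℝ) k).hasFDerivAt

theorem differentiableAt_alphaMap {n : ℕ} (α : ℝ) {θ : Fin n → ℝ} (hθ : ∀ k, 0 < θ k) :
    DifferentiableAt ℝ (alphaMap α) θ :=
  differentiableAt_pi.2 fun k => (hasFDerivAt_alphaMap_apply α hθ k).differentiableAt

theorem fderiv_alphaMap_apply {n : ℕ} (α : ℝ) {θ : Fin n → ℝ} (hθ : ∀ k, 0 < θ k)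
    (v : Fin n → ℝ) (k : Fin n) :
    fderiv ℝ (alphaMap α) θ v k = θ k ^ (-((1 + α) / 2)) * v k := by
  have h := (hasFDerivAt_pi'.1 (differentiableAt_alphaMap α hθ).hasFDerivAt k).unique
    (hasFDerivAt_alphaMap_apply α hθ k)
  simpa using DFunLike.congr_fun h v

/-! ### The immersion `φ_α ∘ ψ` and its normal field -/

section Parametrized

variable {n : ℕ} {U : Set (Fin (n - 1) → ℝ)} {ψ : (Fin (n - 1) → ℝ) → (Fin n → ℝ)}

theorem contDiffOn_alphaMap_comp (hψ : IsLocalParametrization n U ψ) (α : ℝ) (a : Fin n) :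
    ContDiffOn ℝ ∞ (fun y => alphaMap α (ψ y) a) U := by
  have hc : ContDiffOn ℝ ∞ (fun y => ψ y a) U := contDiffOn_pi.1 hψ.contDiffOn a
  have h0 : ∀ y ∈ U, ψ y a ≠ 0 := fun y hy => ((hψ.mapsTo hy).1 a).ne'
  by_cases h : α = 1
  · simpa only [alphaMap, h, if_true] using hc.log h0
  · simpa only [alphaMap, h, if_false] using
      contDiffOn_const.mul (hc.rpow_const_of_ne h0)

theorem differentiableAt_parametrization (hψ : IsLocalParametrization n U ψ)
    {y : Fin (n - 1) → ℝ} (hy : y ∈ U) : DifferentiableAt ℝ ψ y :=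
  (hψ.contDiffOn.contDiffAt (hψ.isOpen.mem_nhds hy)).differentiableAt (by simp)

theorem partialDeriv_parametrization (hψ : IsLocalParametrization n U ψ)
    {y : Fin (n - 1) → ℝ} (hy : y ∈ U) (j : Fin (n - 1)) (a : Fin n) :
    partialDeriv j (fun y => ψ y a) y = fderiv ℝ ψ y (Pi.single j 1) a := by
  have h := hasFDerivAt_pi'.1 (differentiableAt_parametrization hψ hy).hasFDerivAt a
  rw [partialDeriv, h.fderiv]
  rfl

theorem partialDeriv_alphaMap_comp (hψ : IsLocalParametrization n U ψ) (α : ℝ)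
    {y : Fin (n - 1) → ℝ} (hy : y ∈ U) (j : Fin (n - 1)) (a : Fin n) :
    partialDeriv j (fun y => alphaMap α (ψ y) a) y
      = ψ y a ^ (-((1 + α) / 2)) * fderiv ℝ ψ y (Pi.single j 1) a := by
  have h := (hasFDerivAt_alphaMap_apply α (hψ.mapsTo hy).1 a).comp y
    (differentiableAt_parametrization hψ hy).hasFDerivAt
  have h' := h.fderiv
  simp only [Function.comp_def] at h'
  rw [partialDeriv, h']
  simp

theorem metricMatrix_alphaMetric (hψ : IsLocalParametrization n U ψ) (α : ℝ)
    {y : Fin (n - 1) → ℝ} (hy : y ∈ U) :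
    metricMatrix (alphaMetric α) ψ y = gramMatrix (fun a y => alphaMap α (ψ y) a) y := by
  ext i j
  simp only [metricMatrix, alphaMetric, gramMatrix, Matrix.of_apply,
    fderiv_alphaMap_apply α (hψ.mapsTo hy).1, partialDeriv_alphaMap_comp hψ α hy]

/-- A kernel vector `v` of `AᵀA` satisfies `|Av|² = 0`. Since `A` is the Jacobian of `ψ` with rows
scaled by positive factors, `v` lies in the kernel of an injective map. -/
theorem det_metricMatrix_ne_zero (hψ : IsLocalParametrization n U ψ) (α : ℝ)
    {y : Fin (n - 1) → ℝ} (hy : y ∈ U) : (metricMatrix (alphaMetric α) ψ y).det ≠ 0 := by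
  rw [metricMatrix_alphaMetric hψ α hy]
  intro h0
  obtain ⟨v, hv, hv0⟩ := Matrix.exists_mulVec_eq_zero_iff.2 h0
  set A : Matrix (Fin n) (Fin (n - 1)) ℝ :=
    Matrix.of fun a j => partialDeriv j (fun y => alphaMap α (ψ y) a) y with hA
  have hGA : gramMatrix (fun a y => alphaMap α (ψ y) a) y = A.transpose * A := by
    ext i j
    simp [gramMatrix, hA, Matrix.mul_apply]
  have hAv : A.mulVec v = 0 := by
    rw [hGA, ← Matrix.mulVec_mulVec] at hv0
    have h2 : dotProduct (A.mulVec v) (A.mulVec v) = 0 := by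
      rw [← Matrix.vecMul_transpose, ← Matrix.dotProduct_mulVec, Matrix.vecMul_transpose, hv0,
        dotProduct_zero]
    exact dotProduct_self_eq_zero.1 h2
  refine hv (hψ.immersion y hy ?_)
  rw [map_zero]
  funext a
  have h1 := congrFun hAv a
  simp only [Matrix.mulVec, dotProduct, hA, Matrix.of_apply, partialDeriv_alphaMap_comp hψ α hy,
    Pi.zero_apply, mul_assoc, ← Finset.mul_sum] at h1
  have h3 := (mul_eq_zero.1 h1).resolve_left (Real.rpow_pos_of_pos ((hψ.mapsTo hy).1 a) _).ne'
  have hvsum : v = ∑ j, v j • (Pi.single j (1 : ℝ) : Fin (n - 1) → ℝ) := by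
    simpa using (pi_eq_sum_univ' v)
  rw [hvsum, map_sum, Finset.sum_apply]
  simpa [mul_comm] using h3

theorem sum_fderiv_parametrization (hψ : IsLocalParametrization n U ψ)
    {y : Fin (n - 1) → ℝ} (hy : y ∈ U) (j : Fin (n - 1)) :
    ∑ a, fderiv ℝ ψ y (Pi.single j 1) a = 0 := by
  have hd : ∀ a, DifferentiableAt ℝ (fun y => ψ y a) y :=
    differentiableAt_pi.1 (differentiableAt_parametrization hψ hy)
  simp only [← partialDeriv_parametrization hψ hy]
  rw [← partialDeriv_sum j hd, partialDeriv_congr (g := fun _ => 1) hψ.isOpen hy j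
    fun z hz => (hψ.mapsTo hz).2, partialDeriv_const]

theorem partialDeriv_normal (hψ : IsLocalParametrization n U ψ) (α : ℝ)
    {y : Fin (n - 1) → ℝ} (hy : y ∈ U) (k : Fin (n - 1)) (a : Fin n) :
    partialDeriv k (fun y => ψ y a ^ ((1 + α) / 2)) y
      = (1 + α) / 2 * ψ y a ^ α * partialDeriv k (fun y => alphaMap α (ψ y) a) y := by
  have hpos := (hψ.mapsTo hy).1 a
  have h := (hasFDerivAt_pi'.1 (differentiableAt_parametrization hψ hy).hasFDerivAt a).rpow_const
    (p := (1 + α) / 2) (Or.inl hpos.ne')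
  rw [partialDeriv_alphaMap_comp hψ α hy, partialDeriv, h.fderiv]
  have : ψ y a ^ ((1 + α) / 2 - 1) = ψ y a ^ α * ψ y a ^ (-((1 + α) / 2)) := by
    rw [← Real.rpow_add hpos]
    congr 1
    ring
  simp [this]
  ring

end Parametrized

end AlphaGeometry

end

/-! ### The scalar curvature formula -/

theorem mainTheorem1 (n : ℕ) (hn : 1 ≤ n) (α : ℝ) (θ : Fin n → ℝ)
    (hθ : θ ∈ AlphaGeometry.simplex n) :
    AlphaGeometry.IsScalarCurvatureAt (AlphaGeometry.alphaMetric α) θ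
      ((1 + α) ^ 2 / (4 * AlphaGeometry.normConst α θ ^ 2) *
        ∑ t, ∑ s ∈ Finset.univ.filter (fun s => t ≠ s),
          θ t ^ α * θ s ^ α *
            (1 - (θ t ^ (α + 1) + θ s ^ (α + 1)) / AlphaGeometry.normConst α θ ^ 2)) := by
  refine ⟨AlphaGeometry.exists_isLocalParametrization hn hθ, ?_⟩
  rintro U ψ hψ x hx rfl
  have hsq : ∀ a, (ψ x a ^ ((1 + α) / 2)) ^ 2 = ψ x a ^ (α + 1) := fun a => by
    rw [← Real.rpow_natCast, ← Real.rpow_mul (hθ.1 a).le]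
    congr 1
    push_cast
    ring
  have hpos : 0 < ∑ a, ψ x a ^ (α + 1) :=
    Finset.sum_pos (fun a _ => Real.rpow_pos_of_pos (hθ.1 a) _) ⟨⟨0, hn⟩, Finset.mem_univ _⟩
  have hc : AlphaGeometry.normConst α (ψ x) ^ 2 = ∑ a, ψ x a ^ (α + 1) :=
    Real.sq_sqrt hpos.le
  have key := AlphaGeometry.scalarCurvature_hypersurface (n := n) (by omega)
    (N := fun a y => ψ y a ^ ((1 + α) / 2)) hψ.isOpen
    (AlphaGeometry.contDiffOn_alphaMap_comp hψ α)
    (fun y hy => AlphaGeometry.metricMatrix_alphaMetric hψ α hy)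
    (fun y hy => AlphaGeometry.det_metricMatrix_ne_zero hψ α hy) hx
    -- The powers in `N` and in the differential of `φ_α` are reciprocal, leaving the coordinate sum
    -- of a tangent vector of the simplex.
    (fun y hy j => by
      rw [← AlphaGeometry.sum_fderiv_parametrization hψ hy j]
      refine Finset.sum_congr rfl fun a _ => ?_
      have hya := (hψ.mapsTo hy).1 a
      rw [AlphaGeometry.partialDeriv_alphaMap_comp hψ α hy, ← mul_assoc, ← Real.rpow_add hya,
        add_neg_cancel, Real.rpow_zero, one_mul])
    (fun a => (differentiableAt_pi.1
      (AlphaGeometry.differentiableAt_parametrization hψ hx) a).rpow_const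
        (Or.inl (hθ.1 a).ne'))
    (by simp only [hsq]; exact hpos.ne') (fun a => (1 + α) / 2 * ψ x a ^ α)
    (fun a k => AlphaGeometry.partialDeriv_normal hψ α hx k a)
  rw [key]
  simp only [hsq, hc]
  rw [Finset.sum_div, Finset.mul_sum]
  refine Finset.sum_congr rfl fun t _ => ?_
  rw [Finset.sum_div, Finset.mul_sum]
  refine Finset.sum_congr rfl fun s _ => ?_
  field_simp
  ring
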